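/- Let $K$ be a field of characteristic $0$. A sequence $(h_0,h_1,h_2,\dots)$ of nonnegative integers is called a level O-sequence of codimension $3$ if $h_1=3$ and there is a proper homogeneous ideal $I$ of $R=K[x_1,x_2,x_3]$ such that $A=R/I=\bigoplus_t A_t$ is Artinian, $\dim_K A_t=h_t$ for all $t\ge 0$, and $A$ is level, i.e. the socle $\{a\in A : a\,(x_1,x_2,x_3)=0\}$ of $A$ is concentrated in a single degree. (a) For every integer $d\ge 5$ there is a level O-sequence of codimension $3$ with $$h_{d-1}>h_d=h_{d+1}\quad\text{and}\quad h_d=2d+4 .$$ (b) For all integers $d\ge 5$ and $k$ with $5\le k\le \frac{d^2-3d-2}{2}$ there is a level O-sequence of codimension $3$ with $$2d+(k+1)=h_{d-1}>h_d=h_{d+1}=2d+k .$$ -/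

import Mathlib

open MvPolynomial

namespace LevelSeq

noncomputable section

attribute [local instance] MvPolynomial.gradedAlgebra

variable {K : Type*} [Field K] {n : ℕ}

/-- The degree `t` component `A_t` of `A = R/I`, `R = K[x_1, …, x_n]`: the image in `A` of the space
`R_t` of forms of degree `t`. For a homogeneous ideal `I` this is `R_t / I_t`. -/
def gradedPiece (I : Ideal (MvPolynomial (Fin n) K)) (t : ℕ) :
    Submodule K (MvPolynomial (Fin n) K ⧸ I) :=
  (homogeneousSubmodule (Fin n) K t).map (Ideal.Quotient.mkₐ K I).toLinearMap

/-- The Hilbert function `t ↦ dim_K A_t` of `A = R/I`. -/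
def hilbertFunction (I : Ideal (MvPolynomial (Fin n) K)) (t : ℕ) : ℕ :=
  Module.finrank K (gradedPiece I t)

/-- The ideal `m` of `A = R/I` generated by the classes of the variables. -/
def irrelevantIdeal (I : Ideal (MvPolynomial (Fin n) K)) :
    Ideal (MvPolynomial (Fin n) K ⧸ I) :=
  (Ideal.span (Set.range (X : Fin n → MvPolynomial (Fin n) K))).map (Ideal.Quotient.mk I)

/-- The socle `{a ∈ A | a m = 0}` of `A = R/I`. -/
def socle (I : Ideal (MvPolynomial (Fin n) K)) : Ideal (MvPolynomial (Fin n) K ⧸ I) :=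
  (irrelevantIdeal I).annihilator

/-- `A = R/I` is a (nonzero, standard graded) Artinian level algebra: `I` is a proper homogeneous
ideal, `A` is Artinian, and the socle of `A` is concentrated in a single degree `s`. (The socle of a
nonzero graded Artinian algebra is nonzero and contains the last nonzero component, so `s` is
necessarily the socle degree and the socle is then equal to `A_s`.) -/
structure IsLevelAlgebra (I : Ideal (MvPolynomial (Fin n) K)) : Prop where
  homogeneous : I.IsHomogeneous (homogeneousSubmodule (Fin n) K)
  proper : I ≠ ⊤
  artinian : IsArtinianRing (MvPolynomial (Fin n) K ⧸ I)
  level : ∃ s : ℕ, (socle I).restrictScalars K ≤ gradedPiece I s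

/-- `h = (h_0, h_1, …)` is a level O-sequence of codimension `c` over `K`: it is the Hilbert function
of an Artinian level quotient of `K[x_1, …, x_c]`, and `h_1 = c`. The sequence is extended by `0`
beyond the socle degree. -/
def IsLevelOSequence (K : Type*) [Field K] (c : ℕ) (h : ℕ → ℕ) : Prop :=
  h 1 = c ∧ ∃ I : Ideal (MvPolynomial (Fin c) K), IsLevelAlgebra I ∧ ∀ t, h t = hilbertFunction I t

end

end LevelSeq

/-!
The algebras are built from Macaulay's inverse systems: a space of linear functionals on the forms
of degree `s` determines the largest homogeneous ideal on which they all vanish and which contains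
all forms of degree greater than `s`. Its quotient is automatically Artinian and level with socle
degree `s` (`isLevelAlgebra_inverseSystemIdeal`), and its Hilbert function in degree `t` is the
dimension of the space of functionals on forms of degree `t` obtained by contraction with forms of
degree `s - t` (`hilbertFunction_eq_card`).

Write `d = e + 5` and `s = d + 1`, and take three kinds of generators in degree `s`.

* The coefficients at the monomials not divisible by `x * y`. They form the inverse system of a pair
  of lines and contribute `2 * t + 1` in degree `t`, so `-2` per step down from the socle degree.
* One dual form, `x³y³zᵉ + x²y²zᵉ⁺²` in divided powers, whose contractions contribute `1`, `3`, `6`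
  in degrees `s`, `s - 1`, `s - 2`.
* The evaluations at `r` general points, which contribute `r` in each of these degrees.

If all these functionals are independent, the Hilbert function in degrees `d - 1`, `d`, `d + 1` is
`2 * d + 5 + r`, `2 * d + 4 + r`, `2 * d + 4 + r`. So `k = r + 4`; part (a) is the case `r = 0`.

Independence is checked on forms divisible by `x * y`, where the first kind of functional vanishes.
In degree `d - 1` it is a statement about forms of degree `d - 3`: the six second-order contractions
of the dual form are independent (`exists_dualForm_eq`), and `r` general points impose independent
conditions on their common kernel as long as `r + 6` is at most `(d - 1).choose 2`, the dimension of
the space of forms of degree `d - 3` (`exists_points_dualForm`). This is exactly the bound on `k`.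
Degrees `d` and `d + 1` follow upon multiplication by `x` and `x ^ 2` (`conditions_surjective`).
-/

namespace LevelSeq

/-! ### Level algebras from inverse systems -/

section InverseSystem

variable {K : Type*} [Field K] {n : ℕ} {ι : Type*}

theorem homogeneousComponent_monomial_mul (m : Fin n →₀ ℕ) (a : K)
    (f : MvPolynomial (Fin n) K) (t : ℕ) :
    homogeneousComponent (m.degree + t) (monomial m a * f) =
      monomial m a * homogeneousComponent t f := by
  ext d
  rw [coeff_homogeneousComponent, coeff_monomial_mul', coeff_monomial_mul',
    coeff_homogeneousComponent]
  by_cases h : m ≤ d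
  · have hd : d.degree = m.degree + (d - m).degree := by
      rw [← map_add, add_tsub_cancel_of_le h]
    simp [h, hd]
  · simp [h]

/-- The annihilator of the inverse system generated in degree `s` by the restrictions of the
functionals `Φ i` to the forms of degree `s`: the largest homogeneous ideal on whose forms of degree
`s` all `Φ i` vanish. The values of `Φ i` in other degrees play no role, so arbitrary functionals
(such as evaluation at a point) may be used. -/
noncomputable def inverseSystemIdeal (s : ℕ) (Φ : ι → MvPolynomial (Fin n) K →ₗ[K] K) :
    Ideal (MvPolynomial (Fin n) K) where
  carrier := {f | ∀ i g, Φ i (homogeneousComponent s (g * f)) = 0}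
  add_mem' := by
    intro a b ha hb i g
    rw [mul_add, map_add, map_add, ha, hb, add_zero]
  zero_mem' := by intro i g; simp
  smul_mem' := by
    intro c f hf i g
    rw [smul_eq_mul, ← mul_assoc]
    exact hf i _

variable (s : ℕ) (Φ : ι → MvPolynomial (Fin n) K →ₗ[K] K)

theorem mem_inverseSystemIdeal_iff_monomial (f : MvPolynomial (Fin n) K) :
    f ∈ inverseSystemIdeal s Φ ↔
      ∀ i m, Φ i (homogeneousComponent s (monomial m 1 * f)) = 0 := by
  refine ⟨fun h i m => h i _, fun h i g => ?_⟩
  induction g using MvPolynomial.induction_on' with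
  | monomial m a =>
    have : (monomial m a : MvPolynomial (Fin n) K) = a • monomial m 1 := by
      rw [smul_monomial, smul_eq_mul, mul_one]
    rw [this, smul_mul_assoc, map_smul, map_smul, h, smul_zero]
  | add p q hp hq => rw [add_mul, map_add, map_add, hp, hq, add_zero]

theorem mem_inverseSystemIdeal_of_isHomogeneous {t : ℕ} {f : MvPolynomial (Fin n) K}
    (hf : f.IsHomogeneous t) :
    f ∈ inverseSystemIdeal s Φ ↔
      ∀ i m, m.degree + t = s → Φ i (monomial m 1 * f) = 0 := by
  rw [mem_inverseSystemIdeal_iff_monomial]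
  have key : ∀ m : Fin n →₀ ℕ, (monomial m (1 : K) * f).IsHomogeneous (m.degree + t) :=
    fun m => (isHomogeneous_monomial 1 rfl).mul hf
  refine forall₂_congr fun i m => ?_
  rw [homogeneousComponent_of_mem (key m)]
  split_ifs with h
  · simp [h]
  · simp [Ne.symm h]

theorem homogeneousComponent_mem_inverseSystemIdeal {f : MvPolynomial (Fin n) K}
    (hf : f ∈ inverseSystemIdeal s Φ) (t : ℕ) :
    homogeneousComponent t f ∈ inverseSystemIdeal s Φ := by
  rw [mem_inverseSystemIdeal_of_isHomogeneous s Φ (homogeneousComponent_isHomogeneous t f)]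
  rintro i m rfl
  rw [← homogeneousComponent_monomial_mul]
  exact hf i _

theorem inverseSystemIdeal_isHomogeneous :
    letI := MvPolynomial.gradedAlgebra (R := K) (σ := Fin n)
    (inverseSystemIdeal s Φ).IsHomogeneous (homogeneousSubmodule (Fin n) K) :=
  fun t f hf => by
    have h := homogeneousComponent_mem_inverseSystemIdeal s Φ hf t
    rw [← decomposition.decompose'_apply] at h
    exact h

theorem mem_inverseSystemIdeal_of_lt {t : ℕ} (ht : s < t) {f : MvPolynomial (Fin n) K}
    (hf : f.IsHomogeneous t) : f ∈ inverseSystemIdeal s Φ := by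
  rw [mem_inverseSystemIdeal_of_isHomogeneous s Φ hf]
  intro i m h
  omega

theorem mem_inverseSystemIdeal_of_components {f : MvPolynomial (Fin n) K}
    (h : ∀ t, homogeneousComponent t f ∈ inverseSystemIdeal s Φ) :
    f ∈ inverseSystemIdeal s Φ := by
  rw [← sum_homogeneousComponent f]
  exact Ideal.sum_mem _ fun t _ => h t

instance finite_homogeneousSubmodule (t : ℕ) :
    Module.Finite K (homogeneousSubmodule (Fin n) K t) :=
  Module.Finite.iff_fg.mpr (homogeneousSubmodule_fg _ _ t)

theorem finite_quotient_inverseSystemIdeal :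
    Module.Finite K (MvPolynomial (Fin n) K ⧸ inverseSystemIdeal s Φ) := by
  have hfin : ∀ t, (gradedPiece (inverseSystemIdeal s Φ) t).FG := fun t =>
    (homogeneousSubmodule_fg _ _ t).map _
  refine ⟨?_⟩
  have htop : (⊤ : Submodule K (MvPolynomial (Fin n) K ⧸ inverseSystemIdeal s Φ)) =
      ⨆ t ∈ Finset.range (s + 1), gradedPiece (inverseSystemIdeal s Φ) t := by
    refine (eq_top_iff.mpr fun a _ => ?_).symm
    obtain ⟨f, rfl⟩ := Ideal.Quotient.mk_surjective a
    rw [← sum_homogeneousComponent f, map_sum]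
    refine Submodule.sum_mem _ fun t _ => ?_
    by_cases ht : t < s + 1
    · exact Submodule.mem_iSup_of_mem t (Submodule.mem_iSup_of_mem (Finset.mem_range.mpr ht)
        ⟨_, homogeneousComponent_mem t f, rfl⟩)
    · rw [Ideal.Quotient.eq_zero_iff_mem.mpr (mem_inverseSystemIdeal_of_lt s Φ (by omega)
        (homogeneousComponent_isHomogeneous t f))]
      exact Submodule.zero_mem _
  rw [htop]
  exact Submodule.fg_biSup _ _ fun t _ => hfin t

/-- A form of degree below `s` killed by every variable already lies in the ideal, because a
monomial of positive degree is divisible by a variable. -/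
theorem socle_inverseSystemIdeal_le :
    (socle (inverseSystemIdeal s Φ)).restrictScalars K ≤
      gradedPiece (inverseSystemIdeal s Φ) s := by
  intro a ha
  obtain ⟨f, rfl⟩ := Ideal.Quotient.mk_surjective a
  have hX : ∀ i, X i * f ∈ inverseSystemIdeal s Φ := by
    intro i
    have h := Submodule.mem_annihilator.mp ha (Ideal.Quotient.mk _ (X i))
      (Ideal.mem_map_of_mem _ (Ideal.subset_span ⟨i, rfl⟩))
    rw [smul_eq_mul, mul_comm, ← map_mul] at h
    exact Ideal.Quotient.eq_zero_iff_mem.mp h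
  refine ⟨homogeneousComponent s f, homogeneousComponent_mem s f, ?_⟩
  refine (Ideal.Quotient.eq.mpr ?_).symm
  refine mem_inverseSystemIdeal_of_components s Φ fun t => ?_
  rw [map_sub, homogeneousComponent_of_mem (homogeneousComponent_isHomogeneous s f)]
  split_ifs with h
  · rw [h, sub_self]
    exact Ideal.zero_mem _
  · rw [sub_zero,
      mem_inverseSystemIdeal_of_isHomogeneous s Φ (homogeneousComponent_isHomogeneous t f)]
    rintro i m rfl
    have hm : m ≠ 0 := by
      rintro rfl
      exact h (by simp)
    obtain ⟨j, hj⟩ := Finsupp.ne_iff.mp hm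
    have hle : Finsupp.single j 1 ≤ m := by
      rw [Finsupp.single_le_iff]
      exact Nat.one_le_iff_ne_zero.mpr hj
    have := hX j
      i (monomial (m - Finsupp.single j 1) 1)
    rwa [← mul_assoc, X, monomial_mul, tsub_add_cancel_of_le hle, mul_one,
      homogeneousComponent_monomial_mul] at this

theorem isLevelAlgebra_inverseSystemIdeal (h : inverseSystemIdeal s Φ ≠ ⊤) :
    IsLevelAlgebra (inverseSystemIdeal s Φ) where
  homogeneous := inverseSystemIdeal_isHomogeneous s Φ
  proper := h
  artinian := by
    have := finite_quotient_inverseSystemIdeal s Φ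
    exact IsArtinianRing.of_finite K _
  level := ⟨s, socle_inverseSystemIdeal_le s Φ⟩

/-- The Hilbert function in degree `t` counts independent linear conditions on the forms of
degree `t` that cut out the ideal in that degree. -/
theorem hilbertFunction_eq_card {J : Type*} [Fintype J] (I : Ideal (MvPolynomial (Fin n) K))
    (t : ℕ) (ψ : MvPolynomial (Fin n) K →ₗ[K] (J → K))
    (hI : ∀ f, f.IsHomogeneous t → (f ∈ I ↔ ψ f = 0))
    (hψ : ∀ c, ∃ f, f.IsHomogeneous t ∧ ψ f = c) :
    hilbertFunction I t = Fintype.card J := by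
  set V := homogeneousSubmodule (Fin n) K t
  set L := (Ideal.Quotient.mkₐ K I).toLinearMap.domRestrict V
  set P := ψ.domRestrict V
  have hL : gradedPiece I t = LinearMap.range L := by
    rw [gradedPiece, LinearMap.range_domRestrict]
  have hker : LinearMap.ker L = LinearMap.ker P := by
    ext ⟨f, hf⟩
    have := hI f hf
    rw [← Ideal.Quotient.eq_zero_iff_mem] at this
    simpa [L, P] using this
  have hP : LinearMap.range P = ⊤ := by
    rw [LinearMap.range_eq_top]
    intro c
    obtain ⟨f, hf, rfl⟩ := hψ c
    exact ⟨⟨f, hf⟩, rfl⟩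
  have h1 := LinearMap.finrank_range_add_finrank_ker L
  have h2 := LinearMap.finrank_range_add_finrank_ker P
  rw [hker, ← h2, hP, finrank_top, Module.finrank_fintype_fun_eq_card] at h1
  rw [hilbertFunction, hL]
  omega

end InverseSystem

/-! ### Dimension counts and general points -/

theorem natCard_degree_eq (t : ℕ) :
    Nat.card {m : Fin 3 →₀ ℕ // m.degree = t} = (t + 2).choose 2 := by
  have h := Finset.card_finsuppAntidiag_nat_eq_choose (s := (Finset.univ : Finset (Fin 3))) t
  have e : Nat.card {m : Fin 3 →₀ ℕ // m.degree = t} =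
      Nat.card ((Finset.univ : Finset (Fin 3)).finsuppAntidiag t) :=
    Nat.card_congr (Equiv.subtypeEquivRight fun m => by
      simp [Finset.mem_finsuppAntidiag, Finsupp.degree_eq_sum])
  rw [e, Nat.card_eq_fintype_card, Fintype.card_coe, h, Finset.card_univ, Fintype.card_fin,
    show 3 + t - 1 = t + 2 by omega]
  exact Nat.choose_symm_add

theorem finrank_homogeneousSubmodule (K : Type*) [Field K] (t : ℕ) :
    Module.finrank K (homogeneousSubmodule (Fin 3) K t) = (t + 2).choose 2 := by
  rw [homogeneousSubmodule_eq_finsupp_supported, ← natCard_degree_eq,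
    (AddMonoidAlgebra.supportedEquivFinsupp _).finrank_eq]
  have := (Finsupp.finite_of_degree_eq (σ := Fin 3) t).fintype
  rw [Module.finrank_finsupp_self K, ← Nat.card_eq_fintype_card]
  rfl

/-- Over an infinite field, evaluation at general points (here: points off the hypersurface `q = 0`)
imposes independent conditions on a space of polynomials, up to its dimension. -/
theorem exists_points_eval_surjective {K : Type*} [Field K] [Infinite K] {n : ℕ}
    (q : MvPolynomial (Fin n) K) (hq : q ≠ 0) (N : Submodule K (MvPolynomial (Fin n) K))
    [Module.Finite K N] (r : ℕ) (hr : r ≤ Module.finrank K N) :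
    ∃ p : Fin r → Fin n → K, (∀ j, eval (p j) q ≠ 0) ∧
      ∀ c : Fin r → K, ∃ g ∈ N, ∀ j, eval (p j) g = c j := by
  induction r with
  | zero => exact ⟨Fin.elim0, fun j => j.elim0, fun c => ⟨0, N.zero_mem, fun j => j.elim0⟩⟩
  | succ r ih =>
    obtain ⟨p, hp, hs⟩ := ih (by omega)
    let L : N →ₗ[K] (Fin r → K) :=
      LinearMap.pi fun j => (aeval (R := K) (p j)).toLinearMap.domRestrict N
    -- The `r` conditions found so far leave a nonzero `g₀`; the next point avoids `q * g₀ = 0`.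
    have hker : LinearMap.ker L ≠ ⊥ := LinearMap.ker_ne_bot_of_finrank_lt (by
      rw [Module.finrank_fintype_fun_eq_card, Fintype.card_fin]; omega)
    obtain ⟨⟨g₀, hgN⟩, hg, hg0⟩ := Submodule.exists_mem_ne_zero_of_ne_bot hker
    have hgp : ∀ j, eval (p j) g₀ = 0 := fun j => by
      have := congrFun (LinearMap.mem_ker.mp hg) j
      simpa [L, aeval_eq_eval] using this
    have hne : q * g₀ ≠ 0 := mul_ne_zero hq fun h => hg0 (Subtype.ext h)
    obtain ⟨x, hx⟩ : ∃ x, eval x (q * g₀) ≠ 0 := by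
      by_contra! h
      exact hne (MvPolynomial.funext fun x => by rw [h, map_zero])
    rw [map_mul] at hx
    refine ⟨Fin.snoc p x, fun j => ?_, fun c => ?_⟩
    · refine Fin.lastCases ?_ (fun j => ?_) j
      · simpa using left_ne_zero_of_mul hx
      · simpa using hp j
    · obtain ⟨g, hgN', hgc⟩ := hs fun j => c j.castSucc
      refine ⟨g + ((c (Fin.last r) - eval x g) / eval x g₀) • g₀,
        N.add_mem hgN' (N.smul_mem _ hgN), fun j => ?_⟩
      refine Fin.lastCases ?_ (fun j => ?_) j
      · simp [smul_eval, div_mul_cancel₀ _ (right_ne_zero_of_mul hx)]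
      · simp [smul_eval, hgc, hgp]

/-! ### Monomials in three variables -/

/-- The exponent vector of the monomial `x ^ a * y ^ b * z ^ c`. -/
noncomputable def expo (a b c : ℕ) : Fin 3 →₀ ℕ := Finsupp.equivFunOnFinite.symm ![a, b, c]

@[simp] theorem expo_zero (a b c : ℕ) : expo a b c 0 = a := rfl
@[simp] theorem expo_one (a b c : ℕ) : expo a b c 1 = b := rfl
@[simp] theorem expo_two (a b c : ℕ) : expo a b c 2 = c := rfl

theorem degree_fin_three (m : Fin 3 →₀ ℕ) : m.degree = m 0 + m 1 + m 2 := by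
  rw [Finsupp.degree_eq_sum, Fin.sum_univ_three]

theorem ext_fin_three {m m' : Fin 3 →₀ ℕ} (h0 : m 0 = m' 0) (h1 : m 1 = m' 1) (h2 : m 2 = m' 2) :
    m = m' := by
  ext i
  fin_cases i <;> assumption

@[simp] theorem degree_expo (a b c : ℕ) : (expo a b c).degree = a + b + c := degree_fin_three _

theorem expo_add (a b c a' b' c' : ℕ) :
    expo a b c + expo a' b' c' = expo (a + a') (b + b') (c + c') := ext_fin_three rfl rfl rfl

theorem expo_inj {a b c a' b' c' : ℕ} :
    expo a b c = expo a' b' c' ↔ a = a' ∧ b = b' ∧ c = c' := by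
  refine ⟨fun h => ⟨?_, ?_, ?_⟩, fun ⟨h0, h1, h2⟩ => by rw [h0, h1, h2]⟩
  · exact DFunLike.congr_fun h 0
  · exact DFunLike.congr_fun h 1
  · exact DFunLike.congr_fun h 2

theorem eq_expo (m : Fin 3 →₀ ℕ) : m = expo (m 0) (m 1) (m 2) := ext_fin_three rfl rfl rfl

/-- There are `2 t + 1` monomials of degree `t` involving at most one of `x` and `y`. -/
theorem natCard_not_dvd_xy (t : ℕ) :
    Nat.card {m : Fin 3 →₀ ℕ // m.degree = t ∧ (m 0 = 0 ∨ m 1 = 0)} = 2 * t + 1 := by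
  let φ : Fin (t + 1) ⊕ Fin t → {m : Fin 3 →₀ ℕ // m.degree = t ∧ (m 0 = 0 ∨ m 1 = 0)} :=
    Sum.elim (fun a => ⟨expo a 0 (t - a), by rw [degree_expo]; omega, Or.inr rfl⟩)
      (fun b => ⟨expo 0 (b + 1) (t - (b + 1)), by rw [degree_expo]; omega, Or.inl rfl⟩)
  have hφ : Function.Bijective φ := by
    constructor
    · rintro (a | a) (b | b) h <;> have h := expo_inj.mp (congrArg Subtype.val h) <;>
        simp only [Sum.inl.injEq, Sum.inr.injEq, reduceCtorEq, Fin.ext_iff] <;> omega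
    · rintro ⟨m, hm, h⟩
      rw [degree_fin_three] at hm
      by_cases h1 : m 1 = 0
      · exact ⟨Sum.inl ⟨m 0, by omega⟩, Subtype.ext
          (ext_fin_three rfl h1.symm (show t - m 0 = m 2 by omega))⟩
      · exact ⟨Sum.inr ⟨m 1 - 1, by omega⟩, Subtype.ext
          (ext_fin_three (show 0 = m 0 by omega) (show m 1 - 1 + 1 = m 1 by omega)
            (show t - (m 1 - 1 + 1) = m 2 by omega))⟩
  rw [← Nat.card_congr (Equiv.ofBijective φ hφ), Nat.card_eq_fintype_card, Fintype.card_sum,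
    Fintype.card_fin, Fintype.card_fin]
  omega

/-! ### The inverse system of two lines, a dual form and general points -/

section

variable {K : Type*} [Field K]

/-- The functional `coeff (x³y³zᵉ) + coeff (x²y²zᵉ⁺²)` on polynomials, that is, the dual form
`x³y³zᵉ + x²y²zᵉ⁺²` in divided powers. -/
noncomputable def dualForm (K : Type*) [Field K] (e : ℕ) : MvPolynomial (Fin 3) K →ₗ[K] K :=
  lcoeff K (expo 3 3 e) + lcoeff K (expo 2 2 (e + 2))

theorem dualForm_apply (e : ℕ) (f : MvPolynomial (Fin 3) K) :
    dualForm K e f = coeff (expo 3 3 e) f + coeff (expo 2 2 (e + 2)) f := rfl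

/-- The six functionals `g ↦ dualForm (m * x * y * g)`, `m` a monomial of degree `2`, are
independent on the forms of degree `e + 2`. -/
theorem exists_dualForm_eq (e : ℕ) (c : (Fin 3 →₀ ℕ) → K) :
    ∃ g : MvPolynomial (Fin 3) K, g.IsHomogeneous (e + 2) ∧
      ∀ m : Fin 3 →₀ ℕ, m.degree = 2 →
        dualForm K e (monomial (m + expo 1 1 0) 1 * g) = c m := by
  -- After division by `x * y` the dual form is `x²y²zᵉ + xyzᵉ⁺²`; it pairs the monomials of
  -- degree `2` among themselves by a matrix that is a permutation up to the entry `(xy, xy)`.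
  refine ⟨monomial (expo 0 2 e) (c (expo 2 0 0)) + monomial (expo 2 0 e) (c (expo 0 2 0)) +
    monomial (expo 1 1 e) (c (expo 0 0 2)) +
    monomial (expo 0 0 (e + 2)) (c (expo 1 1 0) - c (expo 0 0 2)) +
    monomial (expo 0 1 (e + 1)) (c (expo 1 0 1)) +
    monomial (expo 1 0 (e + 1)) (c (expo 0 1 1)), ?_, ?_⟩
  · refine ((((IsHomogeneous.add ?_ ?_).add ?_).add ?_).add ?_).add ?_ <;>
      exact isHomogeneous_monomial _ (by rw [degree_expo]; omega)
  · intro m hm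
    rw [degree_fin_three] at hm
    rw [eq_expo m]
    generalize m 0 = a at *
    generalize m 1 = b at *
    generalize m 2 = d at *
    obtain ⟨rfl, rfl, rfl⟩ | ⟨rfl, rfl, rfl⟩ | ⟨rfl, rfl, rfl⟩ | ⟨rfl, rfl, rfl⟩ |
      ⟨rfl, rfl, rfl⟩ | ⟨rfl, rfl, rfl⟩ :
        (a = 2 ∧ b = 0 ∧ d = 0) ∨ (a = 0 ∧ b = 2 ∧ d = 0) ∨ (a = 0 ∧ b = 0 ∧ d = 2) ∨
        (a = 1 ∧ b = 1 ∧ d = 0) ∨ (a = 1 ∧ b = 0 ∧ d = 1) ∨ (a = 0 ∧ b = 1 ∧ d = 1) := by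
      omega
    all_goals
      simp only [dualForm_apply, mul_add, monomial_mul, expo_add, coeff_add, coeff_monomial,
        expo_inj, one_mul]
      simp [add_comm, show 1 + (e + 1) = e + 2 by omega]

/-- `r` general points impose conditions on the forms of degree `e + 2` that are independent of
each other and of the six conditions coming from the dual form. -/
theorem exists_points_dualForm [Infinite K] (e r : ℕ) (hr : r + 6 ≤ (e + 4).choose 2) :
    ∃ p : Fin r → Fin 3 → K, (∀ j, p j 0 ≠ 0 ∧ p j 1 ≠ 0) ∧
      ∀ (c : (Fin 3 →₀ ℕ) → K) (v : Fin r → K),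
        ∃ g : MvPolynomial (Fin 3) K, g.IsHomogeneous (e + 2) ∧
          (∀ m : Fin 3 →₀ ℕ, m.degree = 2 →
            dualForm K e (monomial (m + expo 1 1 0) 1 * g) = c m) ∧
          ∀ j, eval (p j) g = v j := by
  have : Finite {m : Fin 3 →₀ ℕ // m.degree = 2} := Finsupp.finite_of_degree_eq 2
  have := Fintype.ofFinite {m : Fin 3 →₀ ℕ // m.degree = 2}
  let P : MvPolynomial (Fin 3) K →ₗ[K] ({m : Fin 3 →₀ ℕ // m.degree = 2} → K) :=
    LinearMap.pi fun m => dualForm K e ∘ₗ LinearMap.mulLeft K (monomial (m.1 + expo 1 1 0) 1)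
  let V := homogeneousSubmodule (Fin 3) K (e + 2)
  let N := (LinearMap.ker (P.domRestrict V)).map V.subtype
  have hN : r ≤ Module.finrank K N := by
    have h1 := LinearMap.finrank_range_add_finrank_ker (P.domRestrict V)
    have h2 := Submodule.finrank_le (LinearMap.range (P.domRestrict V))
    rw [Module.finrank_fintype_fun_eq_card, ← Nat.card_eq_fintype_card, natCard_degree_eq] at h2
    rw [finrank_homogeneousSubmodule, show e + 2 + 2 = e + 4 from rfl] at h1
    rw [Submodule.finrank_map_subtype_eq]
    have h3 : (2 + 2).choose 2 = 6 := rfl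
    omega
  obtain ⟨p, hp, hs⟩ := exists_points_eval_surjective (X 0 * X 1 : MvPolynomial (Fin 3) K)
    (mul_ne_zero (X_ne_zero 0) (X_ne_zero 1)) N r hN
  refine ⟨p, fun j => ?_, fun c v => ?_⟩
  · have := hp j
    rw [map_mul, eval_X, eval_X] at this
    exact ⟨left_ne_zero_of_mul this, right_ne_zero_of_mul this⟩
  · obtain ⟨g₁, hg₁, hc⟩ := exists_dualForm_eq e c
    obtain ⟨g₂, hg₂, hv⟩ := hs fun j => v j - eval (p j) g₁
    obtain ⟨⟨g₂, hgV⟩, hgP, rfl⟩ := hg₂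
    refine ⟨g₁ + g₂, hg₁.add hgV, fun m hm => ?_, fun j => ?_⟩
    · have h : dualForm K e (monomial (m + expo 1 1 0) 1 * g₂) = 0 :=
        congrFun (LinearMap.mem_ker.mp hgP) ⟨m, hm⟩
      rw [mul_add, map_add, hc m hm, h, add_zero]
    · have := hv j
      rw [Submodule.subtype_apply] at this
      rw [map_add, this]
      ring

/-- The generators of the inverse system: the coefficients at all monomials not divisible by
`x * y`, the dual form, and the evaluations at the points `p j`. -/
noncomputable def generators (e : ℕ) {r : ℕ} (p : Fin r → Fin 3 → K) :
    {m : Fin 3 →₀ ℕ // m 0 = 0 ∨ m 1 = 0} ⊕ (Unit ⊕ Fin r) → MvPolynomial (Fin 3) K →ₗ[K] K :=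
  Sum.elim (fun m => lcoeff K m.1)
    (Sum.elim (fun _ => dualForm K e) fun j => (aeval (R := K) (p j)).toLinearMap)

variable {e r : ℕ} {p : Fin r → Fin 3 → K} {t c : ℕ}

/-- Every condition `coeff b` with `b` not divisible by `x * y` is in the inverse system, as
multiplication by a power of `z` raises its degree to `s`. -/
theorem coeff_eq_zero_of_mem {s : ℕ} {f : MvPolynomial (Fin 3) K}
    (hf : f.IsHomogeneous t) (hs : c + t = s)
    (hI : f ∈ inverseSystemIdeal s (generators e p)) {b : Fin 3 →₀ ℕ} (hb : b 0 = 0 ∨ b 1 = 0) :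
    coeff b f = 0 := by
  rw [mem_inverseSystemIdeal_of_isHomogeneous s _ hf] at hI
  have h := hI (Sum.inl ⟨expo 0 0 c + b, by simpa using hb⟩) (expo 0 0 c) (by simpa using hs)
  change coeff (expo 0 0 c + b) (monomial (expo 0 0 c) 1 * f) = 0 at h
  rwa [coeff_monomial_mul, one_mul] at h

/-- The conditions cutting out the forms of degree `t` in the ideal, if the socle degree is
`c + t`: coefficients, contractions of the dual form by monomials of degree `c`, evaluations. -/
noncomputable def conditions (e : ℕ) {r : ℕ} (p : Fin r → Fin 3 → K) (t c : ℕ) :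
    MvPolynomial (Fin 3) K →ₗ[K]
      ({m : Fin 3 →₀ ℕ // m.degree = t ∧ (m 0 = 0 ∨ m 1 = 0)} ⊕
        ({m : Fin 3 →₀ ℕ // m.degree = c} ⊕ Fin r) → K) :=
  LinearMap.pi (Sum.elim (fun m => lcoeff K m.1)
    (Sum.elim (fun m => dualForm K e ∘ₗ LinearMap.mulLeft K (monomial m.1 1))
      fun j => (aeval (R := K) (p j)).toLinearMap))

theorem conditions_eq_iff (f : MvPolynomial (Fin 3) K)
    (v : {m : Fin 3 →₀ ℕ // m.degree = t ∧ (m 0 = 0 ∨ m 1 = 0)} ⊕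
        ({m : Fin 3 →₀ ℕ // m.degree = c} ⊕ Fin r) → K) :
    conditions e p t c f = v ↔
      (∀ m, coeff m.1 f = v (Sum.inl m)) ∧
      (∀ m, dualForm K e (monomial m.1 1 * f) = v (Sum.inr (Sum.inl m))) ∧
      ∀ j, eval (p j) f = v (Sum.inr (Sum.inr j)) := by
  rw [funext_iff, Sum.forall, Sum.forall]
  rfl

theorem mem_inverseSystemIdeal_generators_iff {s : ℕ} (hp : ∀ j, p j 0 ≠ 0) (hs : c + t = s)
    {f : MvPolynomial (Fin 3) K} (hf : f.IsHomogeneous t) :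
    f ∈ inverseSystemIdeal s (generators e p) ↔ conditions e p t c f = 0 := by
  rw [conditions_eq_iff]
  constructor
  · intro hI
    refine ⟨fun m => coeff_eq_zero_of_mem hf hs hI m.2.2, fun m => ?_, fun j => ?_⟩
    · rw [mem_inverseSystemIdeal_of_isHomogeneous s _ hf] at hI
      exact hI (Sum.inr (Sum.inl ())) m.1 (by rw [m.2, hs])
    · rw [mem_inverseSystemIdeal_of_isHomogeneous s _ hf] at hI
      have h : eval (p j) (monomial (Finsupp.single 0 c) 1 * f) = 0 :=
        hI (Sum.inr (Sum.inr j)) (Finsupp.single 0 c) (by simpa using hs)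
      rw [map_mul, eval_monomial] at h
      simpa [hp j] using h
  · rintro ⟨hB, hF, hE⟩
    rw [mem_inverseSystemIdeal_of_isHomogeneous s _ hf]
    rintro (⟨b, hb⟩ | u | j) m hm
    · change coeff b (monomial m 1 * f) = 0
      rw [coeff_monomial_mul']
      split_ifs with hle
      · rw [one_mul]
        by_cases hd : (b - m).degree = t
        · exact hB ⟨b - m, hd, by simp only [Finsupp.tsub_apply]; omega⟩
        · exact hf.coeff_eq_zero hd
      · rfl
    · exact hF ⟨m, by omega⟩
    · have h := hE j
      change eval (p j) (monomial m 1 * f) = 0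
      rw [map_mul, h]
      exact mul_zero _

theorem exists_coeff_eq (S : (Fin 3 →₀ ℕ) → Prop) (hS : ∀ m, S m → m.degree = t)
    (β : {m : Fin 3 →₀ ℕ // S m} → K) :
    ∃ f : MvPolynomial (Fin 3) K, f.IsHomogeneous t ∧ ∀ m, coeff m.1 f = β m := by
  classical
  have : Finite {m : Fin 3 →₀ ℕ // S m} :=
    Set.Finite.subset (Finsupp.finite_of_degree_eq t) hS
  have := Fintype.ofFinite {m : Fin 3 →₀ ℕ // S m}
  refine ⟨∑ m, monomial m.1 (β m), ?_, fun m => ?_⟩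
  · exact IsHomogeneous.sum _ _ _ fun m _ => isHomogeneous_monomial _ (hS _ m.2)
  · simp [coeff_sum, coeff_monomial, ← Subtype.ext_iff]

theorem conditions_surjective (hp : ∀ j, p j 0 ≠ 0 ∧ p j 1 ≠ 0)
    (h : ∀ (c : (Fin 3 →₀ ℕ) → K) (v : Fin r → K),
      ∃ g : MvPolynomial (Fin 3) K, g.IsHomogeneous (e + 2) ∧
        (∀ m : Fin 3 →₀ ℕ, m.degree = 2 →
          dualForm K e (monomial (m + expo 1 1 0) 1 * g) = c m) ∧
        ∀ j, eval (p j) g = v j)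
    (hc : c ≤ 2) (ht : c + t = e + 6)
    (v : {m : Fin 3 →₀ ℕ // m.degree = t ∧ (m 0 = 0 ∨ m 1 = 0)} ⊕
        ({m : Fin 3 →₀ ℕ // m.degree = c} ⊕ Fin r) → K) :
    ∃ f : MvPolynomial (Fin 3) K, f.IsHomogeneous t ∧ conditions e p t c f = v := by
  obtain ⟨f₀, hf₀, hβ⟩ := exists_coeff_eq (fun m => m.degree = t ∧ (m 0 = 0 ∨ m 1 = 0))
    (fun m hm => hm.1) fun m => v (Sum.inl m)
  -- `f₀` settles the coefficients; `x ^ (2 - c) * x * y * g` does not change them and corrects the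
  -- other values.
  obtain ⟨g, hg, hgF, hgE⟩ := h
    (fun m => (if h : (m - expo (2 - c) 0 0).degree = c
      then v (Sum.inr (Sum.inl ⟨m - expo (2 - c) 0 0, h⟩)) else 0) -
        dualForm K e (monomial (m - expo (2 - c) 0 0) 1 * f₀))
    (fun j => (v (Sum.inr (Sum.inr j)) - eval (p j) f₀) / (p j 0 ^ (2 - c + 1) * p j 1))
  refine ⟨f₀ + monomial (expo (2 - c) 0 0 + expo 1 1 0) 1 * g, hf₀.add ?_, ?_⟩
  · have := (isHomogeneous_monomial (1 : K)
      (rfl : (expo (2 - c) 0 0 + expo 1 1 0).degree = _)).mul hg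
    rw [map_add, degree_expo, degree_expo] at this
    convert this using 1
    omega
  · rw [conditions_eq_iff]
    refine ⟨fun m => ?_, fun m => ?_, fun j => ?_⟩
    · rw [coeff_add, hβ, coeff_monomial_mul', if_neg, add_zero]
      intro hle
      have h0 := hle 0
      have h1 := hle 1
      simp only [Finsupp.add_apply, expo_zero, expo_one] at h0 h1
      have := m.2.2
      omega
    · have hd : (m.1 + expo (2 - c) 0 0).degree = 2 := by
        rw [map_add, degree_expo, m.2]
        omega
      have := hgF _ hd
      rw [add_tsub_cancel_right] at this
      rw [mul_add, map_add, ← mul_assoc, monomial_mul, one_mul, ← add_assoc, this, dif_pos m.2]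
      ring
    · have h0 := (hp j).1
      have h1 := (hp j).2
      have hm : eval (p j) (monomial (expo (2 - c) 0 0 + expo 1 1 0) (1 : K)) =
          p j 0 ^ (2 - c + 1) * p j 1 := by
        rw [expo_add, eval_monomial, Finsupp.prod_fintype _ _ (by simp), Fin.prod_univ_three]
        simp
      rw [map_add, map_mul, hm, hgE]
      field_simp
      ring

theorem hilbertFunction_generators (hp : ∀ j, p j 0 ≠ 0 ∧ p j 1 ≠ 0)
    (h : ∀ (c : (Fin 3 →₀ ℕ) → K) (v : Fin r → K),
      ∃ g : MvPolynomial (Fin 3) K, g.IsHomogeneous (e + 2) ∧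
        (∀ m : Fin 3 →₀ ℕ, m.degree = 2 →
          dualForm K e (monomial (m + expo 1 1 0) 1 * g) = c m) ∧
        ∀ j, eval (p j) g = v j)
    (hc : c ≤ 2) (ht : c + t = e + 6) :
    hilbertFunction (inverseSystemIdeal (e + 6) (generators e p)) t =
      2 * t + 1 + ((c + 2).choose 2 + r) := by
  have : Finite {m : Fin 3 →₀ ℕ // m.degree = t ∧ (m 0 = 0 ∨ m 1 = 0)} :=
    Set.Finite.subset (Finsupp.finite_of_degree_eq t) fun m hm => hm.1
  have : Finite {m : Fin 3 →₀ ℕ // m.degree = c} := Finsupp.finite_of_degree_eq c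
  have := Fintype.ofFinite {m : Fin 3 →₀ ℕ // m.degree = t ∧ (m 0 = 0 ∨ m 1 = 0)}
  have := Fintype.ofFinite {m : Fin 3 →₀ ℕ // m.degree = c}
  rw [hilbertFunction_eq_card _ t (conditions e p t c)
    (fun f hf => mem_inverseSystemIdeal_generators_iff (fun j => (hp j).1) ht hf)
    (conditions_surjective hp h hc ht), Fintype.card_sum, Fintype.card_sum, Fintype.card_fin,
    ← Nat.card_eq_fintype_card, ← Nat.card_eq_fintype_card, natCard_not_dvd_xy,
    natCard_degree_eq]

theorem hilbertFunction_generators_one (p : Fin r → Fin 3 → K) :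
    hilbertFunction (inverseSystemIdeal (e + 6) (generators e p)) 1 = 3 := by
  have : Finite {m : Fin 3 →₀ ℕ // m.degree = 1} := Finsupp.finite_of_degree_eq 1
  have := Fintype.ofFinite {m : Fin 3 →₀ ℕ // m.degree = 1}
  rw [hilbertFunction_eq_card (J := {m : Fin 3 →₀ ℕ // m.degree = 1}) _ 1
    (LinearMap.pi fun m => lcoeff K m.1), ← Nat.card_eq_fintype_card, natCard_degree_eq]
  · rfl
  · intro f hf
    constructor
    · intro hI
      funext m
      have h := degree_fin_three m.1
      rw [m.2] at h
      exact coeff_eq_zero_of_mem (c := e + 5) hf rfl hI (by omega)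
    · intro h0
      have : f = 0 := by
        ext m
        by_cases hm : m.degree = 1
        · exact congrFun h0 ⟨m, hm⟩
        · exact hf.coeff_eq_zero hm
      rw [this]
      exact Ideal.zero_mem _
  · intro v
    obtain ⟨f, hf, hv⟩ := exists_coeff_eq (fun m : Fin 3 →₀ ℕ => m.degree = 1) (fun _ h => h) v
    exact ⟨f, hf, funext hv⟩

end

/-- Values of the sequence in the last three degrees `e + 4`, `e + 5`, `e + 6`. -/
theorem exists_isLevelOSequence (K : Type*) [Field K] [Infinite K] (e r : ℕ)
    (hr : r + 6 ≤ (e + 4).choose 2) :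
    ∃ h : ℕ → ℕ, IsLevelOSequence K 3 h ∧ h (e + 4) = 2 * e + 15 + r ∧
      h (e + 5) = 2 * e + 14 + r ∧ h (e + 6) = 2 * e + 14 + r := by
  obtain ⟨p, hp, hs⟩ := exists_points_dualForm (K := K) e r hr
  have h1 := hilbertFunction_generators_one (e := e) p
  refine ⟨hilbertFunction (inverseSystemIdeal (e + 6) (generators e p)),
    ⟨h1, _, isLevelAlgebra_inverseSystemIdeal _ _ fun htop => ?_, fun _ => rfl⟩, ?_, ?_, ?_⟩
  · -- The zero ring has Hilbert function `0`, not `3`, in degree `1`.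
    have : Subsingleton (MvPolynomial (Fin 3) K ⧸ inverseSystemIdeal (e + 6) (generators e p)) :=
      Ideal.Quotient.subsingleton_iff.mpr htop
    rw [hilbertFunction, Module.finrank_zero_of_subsingleton] at h1
    omega
  · rw [hilbertFunction_generators (c := 2) hp hs le_rfl (by omega)]
    have : (2 + 2).choose 2 = 6 := rfl
    omega
  · rw [hilbertFunction_generators (c := 1) hp hs (by omega) (by omega)]
    have : (1 + 2).choose 2 = 3 := rfl
    omega
  · rw [hilbertFunction_generators (c := 0) hp hs (by omega) (by omega)]
    have : (0 + 2).choose 2 = 1 := rfl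
    omega

end LevelSeq

theorem proposition4p9 (K : Type*) [Field K] [CharZero K] :
    (∀ d : ℕ, 5 ≤ d → ∃ h : ℕ → ℕ, LevelSeq.IsLevelOSequence K 3 h ∧
      h (d - 1) > h d ∧ h d = h (d + 1) ∧ h d = 2 * d + 4) ∧
    (∀ d k : ℕ, 5 ≤ d → 5 ≤ k → (k : ℚ) ≤ ((d : ℚ) ^ 2 - 3 * d - 2) / 2 →
      ∃ h : ℕ → ℕ, LevelSeq.IsLevelOSequence K 3 h ∧
        h (d - 1) = 2 * d + (k + 1) ∧ h (d - 1) > h d ∧ h d = h (d + 1) ∧ h d = 2 * d + k) := by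
  constructor
  · intro d hd
    obtain ⟨e, rfl⟩ := Nat.exists_eq_add_of_le' hd
    obtain ⟨h, hh, h4, h5, h6⟩ := LevelSeq.exists_isLevelOSequence K e 0
      (Nat.choose_le_choose 2 (by omega : 4 ≤ e + 4))
    refine ⟨h, hh, ?_⟩
    rw [show e + 5 - 1 = e + 4 by omega, show e + 5 + 1 = e + 6 by omega]
    omega
  · intro d k hd hk hdk
    obtain ⟨e, rfl⟩ := Nat.exists_eq_add_of_le' hd
    obtain ⟨r, rfl⟩ := Nat.exists_eq_add_of_le' hk
    have hr : r + 1 + 6 ≤ (e + 4).choose 2 := by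
      have : ((r + 1 + 6 : ℕ) : ℚ) ≤ ((e + 4).choose 2 : ℕ) := by
        rw [Nat.cast_choose_two]
        push_cast at hdk ⊢
        linarith
      exact_mod_cast this
    obtain ⟨h, hh, h4, h5, h6⟩ := LevelSeq.exists_isLevelOSequence K e (r + 1) hr
    refine ⟨h, hh, ?_⟩
    rw [show e + 5 - 1 = e + 4 by omega, show e + 5 + 1 = e + 6 by omega]
    omega
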